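/- A subset $E$ of a topological space $X$ is called resolvable if there is a decreasing transfinite sequence $\langle F_\xi\rangle$ of closed subsets of $X$ such that $$E=(F_0\setminus F_1)\cup(F_2\setminus F_3)\cup\dots\cup(F_\xi\setminus F_{\xi+1})\cup\cdots,$$ where $\xi$ runs over the even ordinals (limit ordinals being even). A mapping $f\colon X\to Y$ of topological spaces is called resolvable-measurable if $f^{-1}(U)$ is a resolvable subset of $X$ for every open set $U\subset Y$. Let $\dim$ denote the covering dimension: $\dim X\le n$ (for an integer $n\ge -1$) if every finite open cover of $X$ has a finite open refinement such that every point of $X$ lies in at most $n+1$ of its members; $\dim X$ is the least such $n$, and $\dim X=\infty$ if there is none (so $\dim X=-1$ exactly when $X=\emptyset$). Let $X$ and $Y$ be metrizable spaces and let $f\colon X\to Y$ be a bijection such that both $f$ and $f^{-1}$ are resolvable-measurable. Then $\dim X=\dim Y$. -/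

import Mathlib

universe u v

/-- A subset `E` of a topological space is resolvable if
`E = (F₀ \ F₁) ∪ (F₂ \ F₃) ∪ ⋯ ∪ (F_η \ F_{η+1}) ∪ ⋯`, `η` running over the even ordinals, for some
decreasing transfinite sequence of closed sets. With ordinal multiplication the even ordinals are
exactly the ordinals `2 * ξ` (limit ordinals included, e.g. `2 * ω = ω`). The sequence has length
`2 * α`; its values beyond that length are irrelevant. -/
def IsResolvable {X : Type u} [TopologicalSpace X] (E : Set X) : Prop :=
  ∃ (α : Ordinal.{u}) (F : Ordinal.{u} → Set X),
    Antitone F ∧ (∀ ξ, IsClosed (F ξ)) ∧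
      E = ⋃ ξ ∈ Set.Iio α, F (2 * ξ) \ F (2 * ξ + 1)

/-- `f` is resolvable-measurable if preimages of open sets are resolvable. -/
def ResolvableMeasurable {X : Type u} {Y : Type v} [TopologicalSpace X] [TopologicalSpace Y]
    (f : X → Y) : Prop :=
  ∀ U : Set Y, IsOpen U → IsResolvable (f ⁻¹' U)

/-- `𝒰` is a finite open cover of `X`. -/
structure IsFiniteOpenCover {X : Type u} [TopologicalSpace X] (𝒰 : Set (Set X)) : Prop where
  finite : 𝒰.Finite
  isOpen : ∀ U ∈ 𝒰, IsOpen U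
  sUnion_eq : ⋃₀ 𝒰 = Set.univ

/-- Covering dimension `< m`, i.e. `≤ m - 1`: every finite open cover has a finite open refinement
of order `≤ m - 1`, that is, one in which every point lies in at most `m` distinct members. -/
def HasCoveringDimLT (X : Type u) [TopologicalSpace X] (m : ℕ) : Prop :=
  ∀ 𝒰 : Set (Set X), IsFiniteOpenCover 𝒰 →
    ∃ 𝒱 : Set (Set X), IsFiniteOpenCover 𝒱 ∧ (∀ V ∈ 𝒱, ∃ U ∈ 𝒰, V ⊆ U) ∧
      ∀ x : X, {V ∈ 𝒱 | x ∈ V}.encard ≤ m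

/-- The covering dimension, with values in `{-1, 0, 1, 2, …, ∞}`, where `⊥` stands for `-1` (the
dimension of the empty space) and `⊤` for `∞`. -/
noncomputable def coveringDim (X : Type u) [TopologicalSpace X] : WithBot ℕ∞ :=
  sInf {d | ∀ m : ℕ, d < m → HasCoveringDimLT X m}

/-! A resolvable set is locally decided, and this weak property is all that is used. If preimages of
open sets are locally decided, `f` is weakly discontinuous
(`weaklyDiscontinuousOn_univ_of_isLocallyDecided`): otherwise there is a sequence without isolated
points whose image is relatively discrete, and an open set picking out the odd-indexed terms has an
undecided preimage. Applying this to `f` and then to its inverse, every nonempty closed `B` in `X`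
has a nonempty relatively open piece on which `f` is a homeomorphism onto its image. By the subset
theorem the piece has dimension at most `dim Y`; the sum theorems for closed and open sets glue such
pieces (`dimLTOn_univ_of_forall_isClosed`). Hence `dim X ≤ dim Y`, and symmetrically. -/

open Set Topology

/-! ### Resolvable sets and weak discontinuity -/

/-- `E` is locally decided if every nonempty set `B` has a nonempty relatively open subset lying
in `E` or in its complement. -/
def IsLocallyDecided {X : Type u} [TopologicalSpace X] (E : Set X) : Prop :=
  ∀ B : Set X, B.Nonempty →
    ∃ V, IsOpen V ∧ (V ∩ B).Nonempty ∧ (V ∩ B ⊆ E ∨ V ∩ B ⊆ Eᶜ)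

/-- At the first `ξ` with `B ⊄ F ξ`, the piece `B \ F ξ` lies in all earlier `F η`, so the index `ξ`
alone decides whether it lies in `E`. -/
theorem IsResolvable.isLocallyDecided {X : Type u} [TopologicalSpace X] {E : Set X}
    (hE : IsResolvable E) : IsLocallyDecided E := by
  obtain ⟨α, F, hF, hcl, rfl⟩ := hE
  intro B hB
  by_cases h : ∃ ξ, ¬ B ⊆ F ξ
  · obtain ⟨ξ, hξ, hmin⟩ := WellFounded.has_min (wellFounded_lt (α := Ordinal.{u}))
      {ξ | ¬ B ⊆ F ξ} h
    have hlt : ∀ η < ξ, B ⊆ F η := fun η hη => by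
      by_contra hc
      exact hmin η hc hη
    refine ⟨(F ξ)ᶜ, (hcl ξ).isOpen_compl, ?_, ?_⟩
    · obtain ⟨x, hx, hx'⟩ := not_subset.1 hξ
      exact ⟨x, hx', hx⟩
    by_cases hodd : ∃ ζ < α, ξ = 2 * ζ + 1
    · left
      obtain ⟨ζ, hζ, rfl⟩ := hodd
      rintro x ⟨hx, hxB⟩
      exact mem_biUnion hζ ⟨hlt _ (lt_add_one _) hxB, hx⟩
    · right
      rintro x ⟨hx, hxB⟩ hxE
      obtain ⟨ζ, hζ, hx1, hx2⟩ := mem_iUnion₂.1 hxE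
      refine hodd ⟨ζ, hζ, le_antisymm ?_ ?_⟩
      · by_contra hc
        exact hx2 (hlt _ (not_le.1 hc) hxB)
      · rw [← Order.succ_eq_add_one, Order.succ_le_iff]
        by_contra hc
        exact hx (hF (not_lt.1 hc) hx1)
  · push Not at h
    refine ⟨univ, isOpen_univ, by simpa using hB, Or.inr ?_⟩
    rintro x ⟨-, hxB⟩ hxE
    obtain ⟨ζ, hζ, hx1, hx2⟩ := mem_iUnion₂.1 hxE
    exact hx2 (h _ hxB)

/-- `f` is weakly discontinuous on `A` if every nonempty `B ⊆ A` has a nonempty relatively open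
subset on which `f` is continuous. -/
def WeaklyDiscontinuousOn {X : Type u} {Y : Type v} [TopologicalSpace X] [TopologicalSpace Y]
    (f : X → Y) (A : Set X) : Prop :=
  ∀ B ⊆ A, B.Nonempty → ∃ V, IsOpen V ∧ (V ∩ B).Nonempty ∧ ContinuousOn f (V ∩ B)

namespace WeaklyDiscontinuousOn

variable {X : Type u} {Y : Type v} [TopologicalSpace X] [TopologicalSpace Y] {f : X → Y}

theorem mono {A A' : Set X} (h : WeaklyDiscontinuousOn f A') (hA : A ⊆ A') :
    WeaklyDiscontinuousOn f A :=
  fun B hB hne => h B (hB.trans hA) hne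

theorem of_inter_of_inter_compl {A E : Set X} (hE : IsLocallyDecided E)
    (h₁ : WeaklyDiscontinuousOn f (A ∩ E)) (h₂ : WeaklyDiscontinuousOn f (A ∩ Eᶜ)) :
    WeaklyDiscontinuousOn f A := by
  intro B hB hne
  obtain ⟨V, hV, hVB, hVE⟩ := hE B hne
  have key : ∃ W, IsOpen W ∧ (W ∩ (V ∩ B)).Nonempty ∧ ContinuousOn f (W ∩ (V ∩ B)) := by
    rcases hVE with hVE | hVE
    · exact h₁ _ (subset_inter (inter_subset_right.trans hB) hVE) hVB
    · exact h₂ _ (subset_inter (inter_subset_right.trans hB) hVE) hVB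
  obtain ⟨W, hW, hWB, hc⟩ := key
  rw [← inter_assoc] at hWB hc
  exact ⟨W ∩ V, hW.inter hV, hWB, hc⟩

theorem inter_preimage_singleton (A : Set X) (y : Y) :
    WeaklyDiscontinuousOn f (A ∩ f ⁻¹' {y}) := by
  intro B hB hne
  refine ⟨univ, isOpen_univ, by simpa using hne, ?_⟩
  exact (continuousOn_const (c := y)).congr fun x hx => (hB hx.2).2

end WeaklyDiscontinuousOn

/-! ### Points where weak discontinuity fails irreducibly -/

section Irreducible

variable {X : Type u} {Y : Type v} [TopologicalSpace X] [TopologicalSpace Y] {f : X → Y}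

theorem not_weaklyDiscontinuousOn_diff_preimage_finite [T1Space Y]
    (hf : ∀ U, IsOpen U → IsLocallyDecided (f ⁻¹' U)) {A : Set X}
    (hA : ¬ WeaklyDiscontinuousOn f A) {S : Set Y} (hS : S.Finite) :
    ¬ WeaklyDiscontinuousOn f (A ∩ f ⁻¹' Sᶜ) := by
  induction S, hS using Set.Finite.induction_on with
  | empty => simpa using hA
  | @insert y S _ _ ih =>
    intro h
    refine ih (.of_inter_of_inter_compl (hf {y}ᶜ isOpen_compl_singleton) (h.mono ?_) ?_)
    · rintro x ⟨⟨hx, hxS⟩, hxy⟩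
      refine ⟨hx, ?_⟩
      rintro (h | h)
      exacts [hxy h, hxS h]
    · rw [← preimage_compl, compl_compl]
      exact .inter_preimage_singleton _ _

/-- If `f` is not weakly discontinuous on `A`, then some point of `A` has arbitrarily small
neighbourhoods on which, outside the preimage of a fixed neighbourhood of its image, `f` is still
not weakly discontinuous. -/
theorem exists_irreducible [RegularSpace Y]
    (hf : ∀ U, IsOpen U → IsLocallyDecided (f ⁻¹' U)) {A : Set X}
    (hA : ¬ WeaklyDiscontinuousOn f A) :
    ∃ x ∈ A, ∃ U, IsOpen U ∧ f x ∈ U ∧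
      ∀ V ∈ 𝓝 x, ¬ WeaklyDiscontinuousOn f (A ∩ (V ∩ f ⁻¹' Uᶜ)) := by
  by_contra! hcon
  unfold WeaklyDiscontinuousOn at hA
  push Not at hA
  obtain ⟨B, hBA, hBne, hB⟩ := hA
  -- `B` has no continuity piece, so no relatively open part of it near `x` can map outside `U`.
  -- Local decidedness then makes the relative interior of `f ⁻¹' U` dense in `B` near `x`.
  have dense_part : ∀ x ∈ B, ∀ U, IsOpen U → f x ∈ U → ∃ V, IsOpen V ∧ x ∈ V ∧
      ∀ V', IsOpen V' → V' ⊆ V → (V' ∩ B).Nonempty →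
        ∃ W, IsOpen W ∧ W ⊆ V' ∧ (W ∩ B).Nonempty ∧ W ∩ B ⊆ f ⁻¹' U := by
    intro x hx U hU hxU
    obtain ⟨V, hV, hwd⟩ := hcon x (hBA hx) U hU hxU
    refine ⟨interior V, isOpen_interior, mem_interior_iff_mem_nhds.2 hV, ?_⟩
    intro V' hV' hsub hne
    obtain ⟨W, hW, hWne, hWU⟩ := hf U hU _ hne
    rw [← inter_assoc] at hWne hWU
    refine ⟨W ∩ V', hW.inter hV', inter_subset_right, hWne, hWU.resolve_right fun hc => ?_⟩
    obtain ⟨O, hO, hOne, hOc⟩ := hwd (W ∩ V' ∩ B)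
      (fun z hz => ⟨hBA hz.2, interior_subset (hsub hz.1.2), hc hz⟩) hWne
    rw [← inter_assoc] at hOne hOc
    exact hB _ (hO.inter (hW.inter hV')) hOne hOc
  refine hB univ isOpen_univ (by simpa using hBne) ?_
  rw [univ_inter]
  intro x hx
  rw [ContinuousWithinAt, (closed_nhds_basis (f x)).tendsto_right_iff]
  rintro C ⟨hC, hCcl⟩
  obtain ⟨V, hV, hxV, hVd⟩ := dense_part x hx (interior C) isOpen_interior
    (mem_interior_iff_mem_nhds.2 hC)
  refine mem_nhdsWithin.2 ⟨V, hV, hxV, ?_⟩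
  -- If `f z ∉ C`, the preimages of the disjoint open sets `interior C` and `Cᶜ` would both have
  -- dense interior near `z`.
  rintro z ⟨hzV, hzB⟩
  by_contra hz
  obtain ⟨V', hV', hzV', hVd'⟩ := dense_part z hzB Cᶜ hCcl.isOpen_compl hz
  obtain ⟨W, hW, hWV, hWne, hWC⟩ := hVd (V ∩ V') (hV.inter hV') inter_subset_left
    ⟨z, ⟨hzV, hzV'⟩, hzB⟩
  obtain ⟨O, hO, hOW, ⟨w, hwO, hwB⟩, hOC⟩ :=
    hVd' W hW (hWV.trans inter_subset_right) hWne
  exact hOC ⟨hwO, hwB⟩ (interior_subset (hWC ⟨hOW hwO, hwB⟩))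

/-- `f` is irreducible at `x` outside `U` if it fails to be weakly discontinuous on `V \ f ⁻¹' U`
for every neighbourhood `V` of `x`. -/
def IrreducibleOutside (f : X → Y) (U : Set Y) (x : X) : Prop :=
  ∀ V ∈ 𝓝 x, ¬ WeaklyDiscontinuousOn f (V ∩ f ⁻¹' Uᶜ)

theorem IrreducibleOutside.mono {U U' : Set Y} {x : X} (h : IrreducibleOutside f U' x)
    (hU : U ⊆ U') : IrreducibleOutside f U x :=
  fun V hV hwd => h V hV (hwd.mono (inter_subset_inter_right _
    (preimage_mono (compl_subset_compl.2 hU))))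

/-- Two exceptional values have disjoint neighbourhoods `U`, `U'`; a set avoiding `C` splits along
`f ⁻¹' U` into parts avoiding `C ∪ U'` and `C ∪ U`, both harmless. -/
theorem IrreducibleOutside.subsingleton_exceptional [T2Space Y]
    (hf : ∀ U, IsOpen U → IsLocallyDecided (f ⁻¹' U)) {C : Set Y} {x : X}
    (h : IrreducibleOutside f C x) :
    {y | ∀ U, IsOpen U → y ∈ U → ¬ IrreducibleOutside f (C ∪ U) x}.Subsingleton := by
  intro y hy y' hy'
  by_contra hne
  obtain ⟨U, U', hU, hU', hyU, hyU', hd⟩ := t2_separation hne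
  have h₁ := hy U hU hyU
  have h₂ := hy' U' hU' hyU'
  unfold IrreducibleOutside at h₁ h₂
  push Not at h₁ h₂
  obtain ⟨V, hV, hwd⟩ := h₁
  obtain ⟨V', hV', hwd'⟩ := h₂
  refine h (V ∩ V') (Filter.inter_mem hV hV')
    (.of_inter_of_inter_compl (hf U hU) (hwd'.mono ?_) (hwd.mono ?_))
  · rintro z ⟨⟨hz, hzC⟩, hzU⟩
    refine ⟨hz.2, ?_⟩
    rintro (hc | hc)
    exacts [hzC hc, hd.notMem_of_mem_left hzU hc]
  · rintro z ⟨⟨hz, hzC⟩, hzU⟩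
    refine ⟨hz.1, ?_⟩
    rintro (hc | hc)
    exacts [hzC hc, hzU hc]

/-- The inductive step of the sequence: each old point has at most one exceptional value, and
discarding these finitely many fibres preserves the failure of weak discontinuity. -/
theorem exists_extension_irreducibleOutside [T3Space Y]
    (hf : ∀ U, IsOpen U → IsLocallyDecided (f ⁻¹' U)) {C : Set Y} {T : Set X} (hT : T.Finite)
    (h : ∀ x ∈ T, IrreducibleOutside f C x) {x₀ : X} (hx₀ : x₀ ∈ T) {V : Set X} (hV : V ∈ 𝓝 x₀) :
    ∃ z ∈ V, f z ∉ C ∧ ∃ U, IsOpen U ∧ f z ∈ U ∧ IrreducibleOutside f (C ∪ U) z ∧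
      ∀ x ∈ T, IrreducibleOutside f (C ∪ U) x := by
  set S : Set Y := ⋃ x ∈ T, {y | ∀ U, IsOpen U → y ∈ U → ¬ IrreducibleOutside f (C ∪ U) x}
  have hS : S.Finite := hT.biUnion fun x hx => ((h x hx).subsingleton_exceptional hf).finite
  obtain ⟨z, ⟨⟨hzV, hzC⟩, hzS⟩, U, hU, hzU, hirr⟩ := exists_irreducible hf
    (not_weaklyDiscontinuousOn_diff_preimage_finite hf (h x₀ hx₀ V hV) hS)
  have hex : ∀ x ∈ T, ∃ O, IsOpen O ∧ f z ∈ O ∧ IrreducibleOutside f (C ∪ O) x := by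
    intro x hx
    by_contra! hc
    exact hzS (mem_biUnion hx hc)
  choose! O hO hzO hirrO using hex
  refine ⟨z, hzV, hzC, U ∩ ⋂ x ∈ T, O x, hU.inter (hT.isOpen_biInter hO),
    ⟨hzU, mem_iInter₂.2 hzO⟩, fun W hW hwd => hirr W hW (hwd.mono ?_), fun x hx => ?_⟩
  · rintro w ⟨⟨⟨-, hwC⟩, -⟩, hwW, hwU⟩
    refine ⟨hwW, ?_⟩
    rintro (hc | hc)
    exacts [hwC hc, hwU hc.1]
  · exact (hirrO x hx).mono (union_subset_union_right _
      (inter_subset_right.trans (biInter_subset_of_mem hx)))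

end Irreducible

/-! ### The crowded sequence -/

/-- A sequence may be built term by term so as to satisfy conditions that depend only on initial
segments. -/
theorem exists_seq_of_forall_exists_update {α : Type*} (P : ℕ → (ℕ → α) → Prop)
    (hP : ∀ n p q, (∀ i ≤ n, p i = q i) → P n p → P n q) (h0 : ∃ p, P 0 p)
    (hs : ∀ n p, P n p → ∃ a, P (n + 1) (Function.update p (n + 1) a)) :
    ∃ q, ∀ n, P n q := by
  obtain ⟨p0, hp0⟩ := h0
  choose a ha using hs
  let s : (n : ℕ) → {p // P n p} := fun n =>
    Nat.rec ⟨p0, hp0⟩ (fun n p => ⟨Function.update p.1 (n + 1) (a n p.1 p.2), ha n p.1 p.2⟩) n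
  have hsucc : ∀ n i, i ≤ n → (s (n + 1)).1 i = (s n).1 i := fun n i hi =>
    Function.update_of_ne (by omega) _ _
  have hstable : ∀ i k, (s (i + k)).1 i = (s i).1 i := by
    intro i k
    induction k with
    | zero => rfl
    | succ k ih => rw [← ih]; exact hsucc (i + k) i (by omega)
  refine ⟨fun n => (s n).1 n, fun n => hP n _ _ (fun i hi => ?_) (s n).2⟩
  obtain ⟨k, rfl⟩ := Nat.exists_eq_add_of_le hi
  exact hstable i k

/-- If `f` is not weakly discontinuous, there is a sequence without isolated points, whose terms
of even index are as dense as those of odd index, with relatively discrete injective image. -/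
theorem exists_crowded_seq {X : Type u} {Y : Type v} [PseudoMetricSpace X] [TopologicalSpace Y]
    [T3Space Y] {f : X → Y} (hf : ∀ U, IsOpen U → IsLocallyDecided (f ⁻¹' U))
    (h : ¬ WeaklyDiscontinuousOn f univ) :
    ∃ (x : ℕ → X) (U : ℕ → Set Y), (∀ n, IsOpen (U n)) ∧ (∀ n, f (x n) ∈ U n) ∧
      (∀ m n, m < n → f (x n) ∉ U m) ∧
      ∀ i k b, b < 2 → dist (x (2 * Nat.pair i k + b + 1)) (x i) < 1 / (k + 1) := by
  -- Term `m + 1` serves the pair coded by `m / 2`; the halving serves each pair twice, at an odd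
  -- and at an even index.
  let P : ℕ → (ℕ → X × Set Y) → Prop := fun n p =>
    (∀ i ≤ n, IsOpen (p i).2 ∧ f (p i).1 ∈ (p i).2 ∧
      IrreducibleOutside f (⋃ j ∈ Iic n, (p j).2) (p i).1 ∧ ∀ j < i, f (p i).1 ∉ (p j).2) ∧
    ∀ m < n, dist (p (m + 1)).1 (p (Nat.unpair (m / 2)).1).1 < 1 / ((Nat.unpair (m / 2)).2 + 1)
  have hidx : ∀ m : ℕ, (Nat.unpair (m / 2)).1 ≤ m := fun m =>
    (Nat.unpair_left_le _).trans (Nat.div_le_self _ _)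
  obtain ⟨q, hq⟩ : ∃ q, ∀ n, P n q := by
    apply exists_seq_of_forall_exists_update
    · rintro n p q hpq ⟨h₁, h₂⟩
      have hU : (⋃ j ∈ Iic n, (q j).2) = ⋃ j ∈ Iic n, (p j).2 :=
        iUnion₂_congr fun j hj => by rw [hpq j hj]
      refine ⟨fun i hi => ?_, fun m hm => ?_⟩
      · rw [hU, ← hpq i hi]
        obtain ⟨a, b, c, d⟩ := h₁ i hi
        refine ⟨a, b, c, fun j hj => ?_⟩
        rw [← hpq j (by omega)]
        exact d j hj
      · rw [← hpq (m + 1) hm, ← hpq _ ((hidx m).trans hm.le)]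
        exact h₂ m hm
    · obtain ⟨x, -, U, hU, hxU, hirr⟩ := exists_irreducible hf h
      refine ⟨fun _ => (x, U), fun i hi => ⟨hU, hxU, fun V hV hwd => hirr V hV ?_, ?_⟩, ?_⟩
      · rw [univ_inter]
        simpa using hwd
      · intro j hj; omega
      · intro m hm; omega
    · rintro n p ⟨h₁, h₂⟩
      set r : ℝ := 1 / ((Nat.unpair (n / 2)).2 + 1)
      have hr : 0 < r := by positivity
      set T : Set X := (fun i => (p i).1) '' Iic n
      obtain ⟨z, hzV, hzC, U, hU, hzU, hz, hold⟩ := exists_extension_irreducibleOutside hf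
        (C := ⋃ j ∈ Iic n, (p j).2) (T := T) ((finite_Iic n).image _)
        (by rintro _ ⟨i, hi, rfl⟩; exact (h₁ i hi).2.2.1)
        (mem_image_of_mem _ (hidx n)) (Metric.ball_mem_nhds _ hr)
      set q := Function.update p (n + 1) (z, U)
      have hqn : q (n + 1) = (z, U) := Function.update_self _ _ _
      have hqo : ∀ i ≤ n, q i = p i := fun i hi => Function.update_of_ne (by omega) _ _
      have hUn : (⋃ j ∈ Iic (n + 1), (q j).2) = (⋃ j ∈ Iic n, (p j).2) ∪ U := by
        have : Iic (n + 1) = insert (n + 1) (Iic n) := by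
          ext i; simp only [mem_Iic, mem_insert_iff]; omega
        rw [this, biUnion_insert, hqn, union_comm]
        congr 1
        exact iUnion₂_congr fun j hj => by rw [hqo j hj]
      suffices hPq : P (n + 1) q from ⟨_, hPq⟩
      refine ⟨fun i hi => ?_, fun m hm => ?_⟩
      · rw [hUn]
        rcases Nat.lt_or_ge n i with hni | hni
        · obtain rfl : i = n + 1 := by omega
          rw [hqn]
          refine ⟨hU, hzU, hz, fun j hj => ?_⟩
          rw [hqo j (by omega)]
          exact fun hc => hzC (mem_biUnion (Nat.lt_succ_iff.1 hj) hc)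
        · rw [hqo i hni]
          obtain ⟨a, b, c, d⟩ := h₁ i hni
          refine ⟨a, b, hold _ (mem_image_of_mem _ hni), fun j hj => ?_⟩
          rw [hqo j (by omega)]
          exact d j hj
      · rcases Nat.lt_or_ge m n with hmn | hmn
        · rw [hqo (m + 1) hmn, hqo _ ((hidx m).trans hmn.le)]
          exact h₂ m hmn
        · obtain rfl : m = n := by omega
          rw [hqn, hqo _ (hidx m)]
          exact hzV
  refine ⟨fun n => (q n).1, fun n => (q n).2, fun n => ((hq n).1 n le_rfl).1,
    fun n => ((hq n).1 n le_rfl).2.1, fun m n hmn => ((hq n).1 n le_rfl).2.2.2 m hmn,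
    fun i k b hb => ?_⟩
  have := (hq (2 * Nat.pair i k + b + 1)).2 (2 * Nat.pair i k + b) (Nat.lt_succ_self _)
  have hdiv : (2 * Nat.pair i k + b) / 2 = Nat.pair i k := by omega
  rw [hdiv, Nat.unpair_pair] at this
  exact this

theorem weaklyDiscontinuousOn_univ_of_isLocallyDecided {X : Type u} {Y : Type v}
    [PseudoMetricSpace X] [TopologicalSpace Y] [T3Space Y] {f : X → Y}
    (hf : ∀ U, IsOpen U → IsLocallyDecided (f ⁻¹' U)) : WeaklyDiscontinuousOn f univ := by
  by_contra h
  obtain ⟨x, U, hU, hxU, hsep, hd⟩ := exists_crowded_seq hf h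
  -- Earlier images are removed by hand and later ones already avoid `U n`, so `O n` isolates `f (x
  -- n)`.
  let O : ℕ → Set Y := fun n => U n \ ((fun j => f (x j)) '' Iio n)
  have hO : ∀ n, IsOpen (O n) := fun n => (hU n).sdiff ((finite_Iio n).image _).isClosed
  have hmem : ∀ m n, f (x m) ∈ O n ↔ m = n := by
    intro m n
    constructor
    · rintro ⟨h₁, h₂⟩
      rcases lt_trichotomy m n with h | h | h
      · exact absurd ⟨m, h, rfl⟩ h₂
      · exact h
      · exact absurd h₁ (hsep n m h)
    · rintro rfl
      refine ⟨hxU m, ?_⟩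
      rintro ⟨j, hj, hjm⟩
      exact hsep j m hj (by rw [← hjm]; exact hxU j)
  have hpar : ∀ m, x m ∈ f ⁻¹' (⋃ n ∈ {n | Odd n}, O n) ↔ Odd m := by
    intro m
    simp [hmem]
  obtain ⟨V, hV, ⟨_, hxV, i, rfl⟩, hdec⟩ := hf (⋃ n ∈ {n | Odd n}, O n)
    (isOpen_biUnion fun n _ => hO n) (range x) (range_nonempty x)
  obtain ⟨ε, hε, hball⟩ := Metric.isOpen_iff.1 hV _ hxV
  obtain ⟨k, hk⟩ := exists_nat_one_div_lt hε
  have hin : ∀ b < 2, x (2 * Nat.pair i k + b + 1) ∈ V ∩ range x := fun b hb =>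
    ⟨hball ((hd i k b hb).trans hk), mem_range_self _⟩
  rcases hdec with hdec | hdec
  · have := (hpar _).1 (hdec (hin 1 (by norm_num)))
    rw [Nat.odd_iff] at this
    omega
  · exact hdec (hin 0 (by norm_num)) ((hpar _).2 (by rw [Nat.odd_iff]; omega))

/-! ### Covering dimension of subsets -/

/-- The subset `A` has covering dimension `< m`, expressed by open shrinkings of finite open
families of the ambient space that cover `A`. -/
def DimLTOn {X : Type u} [TopologicalSpace X] (A : Set X) (m : ℕ) : Prop :=
  ∀ (n : ℕ) (U : Fin n → Set X), (∀ j, IsOpen (U j)) → A ⊆ ⋃ j, U j →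
    ∃ V : Fin n → Set X, (∀ j, IsOpen (V j)) ∧ (∀ j, V j ⊆ U j) ∧ A ⊆ ⋃ j, V j ∧
      ∀ x ∈ A, {j | x ∈ V j}.encard ≤ m

section Topological

variable {X : Type u} [TopologicalSpace X]

theorem hasCoveringDimLT_iff_dimLTOn_univ {m : ℕ} :
    HasCoveringDimLT X m ↔ DimLTOn (univ : Set X) m := by
  constructor
  · intro h n U hU hcov
    obtain ⟨𝒱, h𝒱, href, hord⟩ := h (range U)
      ⟨finite_range U, forall_mem_range.2 hU, by simpa [← univ_subset_iff] using hcov⟩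
    have href' : ∀ V ∈ 𝒱, ∃ j, V ⊆ U j := fun V hV => by simpa using href V hV
    rcases isEmpty_or_nonempty X with hX | ⟨⟨x₀⟩⟩
    · exact ⟨U, hU, fun _ => subset_rfl, hcov, fun x => (hX.false x).elim⟩
    have : Nonempty (Fin n) := by
      obtain ⟨j, -⟩ := mem_iUnion.1 (hcov (mem_univ x₀))
      exact ⟨j⟩
    choose! φ hφ using href'
    -- Merging the members assigned to the same `U j` cannot raise the order.
    refine ⟨fun j => ⋃₀ {V ∈ 𝒱 | φ V = j}, fun j => isOpen_sUnion fun V hV => h𝒱.isOpen V hV.1,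
      fun j => ?_, fun x _ => ?_, fun x _ => ?_⟩
    · rintro x ⟨V, ⟨hV, rfl⟩, hx⟩
      exact hφ V hV hx
    · obtain ⟨V, hV, hx⟩ := h𝒱.sUnion_eq.symm ▸ mem_univ x
      exact mem_iUnion.2 ⟨φ V, V, ⟨hV, rfl⟩, hx⟩
    · refine le_trans (encard_le_encard ?_) ((encard_image_le φ {V ∈ 𝒱 | x ∈ V}).trans (hord x))
      rintro j ⟨V, ⟨hV, rfl⟩, hx⟩
      exact ⟨V, ⟨hV, hx⟩, rfl⟩
  · intro h 𝒰 h𝒰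
    obtain ⟨n, U, -, rfl⟩ := h𝒰.finite.fin_param
    obtain ⟨V, hV, hVU, hcov, hord⟩ := h n U (forall_mem_range.1 h𝒰.isOpen)
      (by rw [← sUnion_range, h𝒰.sUnion_eq])
    refine ⟨range V, ⟨finite_range V, forall_mem_range.2 hV, ?_⟩, ?_, fun x => ?_⟩
    · rw [sUnion_range, ← univ_subset_iff]
      exact hcov
    · rintro _ ⟨j, rfl⟩
      exact ⟨U j, mem_range_self j, hVU j⟩
    · refine le_trans (encard_le_encard ?_) ((encard_image_le V _).trans (hord x (mem_univ x)))
      rintro _ ⟨⟨j, rfl⟩, hx⟩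
      exact ⟨j, hx, rfl⟩

theorem Topology.IsInducing.dimLTOn_image_iff {Z : Type v} [TopologicalSpace Z] {e : Z → X}
    (he : IsInducing e) {B : Set Z} {m : ℕ} : DimLTOn (e '' B) m ↔ DimLTOn B m := by
  constructor
  · intro h n U hU hcov
    choose U' hU' hUU' using fun j => he.isOpen_iff.1 (hU j)
    obtain ⟨V, hV, hVU, hcovV, hord⟩ := h n U' hU' (by
      rw [image_subset_iff, preimage_iUnion]
      simpa only [hUU'] using hcov)
    refine ⟨fun j => e ⁻¹' V j, fun j => (hV j).preimage he.continuous, fun j => ?_, ?_,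
      fun z hz => hord _ (mem_image_of_mem e hz)⟩
    · rw [← hUU' j]
      exact preimage_mono (hVU j)
    · rw [← preimage_iUnion, ← image_subset_iff]
      exact hcovV
  · intro h n U hU hcov
    rw [image_subset_iff, preimage_iUnion] at hcov
    obtain ⟨V, hV, hVU, hcovV, hord⟩ := h n (fun j => e ⁻¹' U j)
      (fun j => (hU j).preimage he.continuous) hcov
    choose V' hV' hVV' using fun j => he.isOpen_iff.1 (hV j)
    have hmem : ∀ j z, e z ∈ V' j ∩ U j ↔ z ∈ V j := fun j z => by
      rw [← hVV' j]
      exact ⟨fun hz => hz.1, fun hz => ⟨hz, hVU j (hVV' j ▸ hz)⟩⟩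
    refine ⟨fun j => V' j ∩ U j, fun j => (hV' j).inter (hU j), fun j => inter_subset_right, ?_, ?_⟩
    · rintro _ ⟨z, hz, rfl⟩
      obtain ⟨j, hj⟩ := mem_iUnion.1 (hcovV hz)
      exact mem_iUnion.2 ⟨j, (hmem j z).2 hj⟩
    · rintro _ ⟨z, hz, rfl⟩
      simpa only [hmem] using hord z hz

theorem dimLTOn_univ_subtype_iff {A : Set X} {m : ℕ} :
    DimLTOn (univ : Set A) m ↔ DimLTOn A m := by
  rw [← IsInducing.subtypeVal.dimLTOn_image_iff, image_univ, Subtype.range_coe]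

theorem DimLTOn.of_isClosed {F : Set X} {m : ℕ} (h : DimLTOn (univ : Set X) m)
    (hF : IsClosed F) : DimLTOn F m := by
  intro n U hU hcov
  rcases F.eq_empty_or_nonempty with rfl | ⟨x₀, hx₀⟩
  · exact ⟨U, hU, fun _ => subset_rfl, hcov, fun x hx => hx.elim⟩
  obtain ⟨V, hV, hVU, hcovV, hord⟩ := h n (fun j => U j ∪ Fᶜ)
    (fun j => (hU j).union hF.isOpen_compl) (fun x _ => by
      by_cases hx : x ∈ F
      · obtain ⟨j, hj⟩ := mem_iUnion.1 (hcov hx)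
        exact mem_iUnion.2 ⟨j, Or.inl hj⟩
      · obtain ⟨j, -⟩ := mem_iUnion.1 (hcov hx₀)
        exact mem_iUnion.2 ⟨j, Or.inr hx⟩)
  refine ⟨fun j => V j ∩ U j, fun j => (hV j).inter (hU j), fun j => inter_subset_right,
    fun x hx => ?_, fun x hx => ?_⟩
  · obtain ⟨j, hj⟩ := mem_iUnion.1 (hcovV (mem_univ x))
    exact mem_iUnion.2 ⟨j, hj, (hVU j hj).resolve_right (not_not.2 hx)⟩
  · exact le_trans (encard_le_encard fun j hj => hj.1) (hord x (mem_univ x))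

/-- A shrinking of small order over `F` extends to a cover by adding `U j \ F`, which leaves the
order on `F` unchanged; normality then supplies the closures. -/
theorem DimLTOn.exists_closure_shrinking [NormalSpace X] {F : Set X} {m : ℕ} (h : DimLTOn F m)
    (hF : IsClosed F) {n : ℕ} {U : Fin n → Set X} (hU : ∀ j, IsOpen (U j)) (hcov : ⋃ j, U j = univ) :
    ∃ V : Fin n → Set X, (∀ j, IsOpen (V j)) ∧ ⋃ j, V j = univ ∧ (∀ j, closure (V j) ⊆ U j) ∧
      ∀ x ∈ F, {j | x ∈ closure (V j)}.encard ≤ m := by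
  obtain ⟨W, hW, hWU, hcovW, hord⟩ := h n U hU (hcov ▸ subset_univ F)
  obtain ⟨V, hcovV, hV, hVW⟩ := exists_iUnion_eq_closure_subset (u := fun j => W j ∪ (U j \ F))
    (fun j => (hW j).union ((hU j).sdiff hF)) (fun _ => toFinite _) (by
      rw [← univ_subset_iff]
      intro x _
      by_cases hx : x ∈ F
      · obtain ⟨j, hj⟩ := mem_iUnion.1 (hcovW hx)
        exact mem_iUnion.2 ⟨j, Or.inl hj⟩
      · obtain ⟨j, hj⟩ := mem_iUnion.1 (hcov.symm ▸ mem_univ x)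
        exact mem_iUnion.2 ⟨j, Or.inr ⟨hj, hx⟩⟩)
  refine ⟨V, hV, hcovV, fun j => (hVW j).trans (union_subset (hWU j) sdiff_subset),
    fun x hx => le_trans (encard_le_encard fun j hj => ?_) (hord x hx)⟩
  exact (hVW j hj).resolve_right fun hc => hc.2 hx

end Topological

/-! ### Sum and subset theorems in metric spaces -/

section Metric

variable {X : Type u} [PseudoMetricSpace X]

/-- A finite family of closed sets can be swollen to open sets without increasing its order. -/
theorem exists_open_swelling {n m : ℕ} {K U : Fin n → Set X} (hK : ∀ j, IsClosed (K j))
    (hU : ∀ j, IsOpen (U j)) (hKU : ∀ j, K j ⊆ U j) (hord : ∀ x, {j | x ∈ K j}.encard ≤ m) :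
    ∃ V : Fin n → Set X, (∀ j, IsOpen (V j)) ∧ (∀ j, K j ⊆ V j) ∧ (∀ j, V j ⊆ U j) ∧
      ∀ x, {j | x ∈ V j}.encard ≤ m := by
  -- The least, over all `m + 1` of the sets, of the largest distance from `x` to one of them (`⊤`
  -- if there are too few sets). It is positive since no `m + 1` of them share a point.
  let r : X → ENNReal := fun x => (Finset.univ.powersetCard (m + 1)).inf fun S : Finset (Fin n) =>
    S.sup fun j => Metric.infEDist x (K j)
  have hr : Continuous r := Continuous.finset_inf_apply fun S _ =>
    Continuous.finset_sup_apply fun j _ => Metric.continuous_infEDist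
  have hpos : ∀ x, 0 < r x := by
    intro x
    rw [Finset.lt_inf_iff ENNReal.zero_lt_top]
    intro S hS
    rw [Finset.lt_sup_iff]
    by_contra! hc
    have hsub : (S : Set (Fin n)) ⊆ {j | x ∈ K j} := fun j hj =>
      (Metric.mem_iff_infEDist_zero_of_closed (hK j)).2 (nonpos_iff_eq_zero.1 (hc j hj))
    have hcard := (encard_le_encard hsub).trans (hord x)
    rw [encard_coe_eq_coe_finsetCard, (Finset.mem_powersetCard.1 hS).2] at hcard
    have : m + 1 ≤ m := by exact_mod_cast hcard
    omega
  refine ⟨fun j => {x | Metric.infEDist x (K j) < r x} ∩ U j,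
    fun j => (isOpen_lt Metric.continuous_infEDist hr).inter (hU j), fun j x hx => ⟨?_, hKU j hx⟩,
    fun j => inter_subset_right, fun x => ?_⟩
  · rw [mem_ofPred_eq, Metric.infEDist_zero_of_mem hx]
    exact hpos x
  · by_contra! hc
    have hc' : ((m + 1 : ℕ) : ℕ∞) ≤
        {j | x ∈ {x | Metric.infEDist x (K j) < r x} ∩ U j}.encard := by
      simpa using Order.add_one_le_of_lt hc
    obtain ⟨S, hS, hScard⟩ := exists_subset_encard_eq hc'
    have hSf : S.Finite := toFinite S
    have hmem : hSf.toFinset ∈ Finset.univ.powersetCard (m + 1) := by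
      rw [Finset.mem_powersetCard]
      refine ⟨Finset.subset_univ _, ?_⟩
      rw [hSf.encard_eq_coe_toFinset_card] at hScard
      exact_mod_cast hScard
    have h₁ : r x ≤ _ := Finset.inf_le hmem
    have h₂ : (hSf.toFinset.sup fun j => Metric.infEDist x (K j)) < r x :=
      (Finset.sup_lt_iff (hpos x)).2 fun j hj => (hS (hSf.mem_toFinset.1 hj)).1
    exact absurd h₁ (not_le.2 h₂)

/-- The countable closed sum theorem. -/
theorem dimLTOn_univ_of_iUnion_isClosed {m : ℕ} {F : ℕ → Set X} (hF : ∀ i, IsClosed (F i))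
    (hcovF : ⋃ i, F i = univ) (h : ∀ i, DimLTOn (F i) m) : DimLTOn (univ : Set X) m := by
  intro n U hU hcov
  let S := {W : Fin n → Set X // (∀ j, IsOpen (W j)) ∧ ⋃ j, W j = univ}
  have hstep : ∀ (i : ℕ) (W : S), ∃ W' : S, (∀ j, closure (W'.1 j) ⊆ W.1 j) ∧
      ∀ x ∈ F i, {j | x ∈ closure (W'.1 j)}.encard ≤ m := fun i W => by
    obtain ⟨V, hV, hVc, hVW, hVo⟩ := (h i).exists_closure_shrinking (hF i) W.2.1 W.2.2
    exact ⟨⟨V, hV, hVc⟩, hVW, hVo⟩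
  choose next hnext hnextord using hstep
  let s : ℕ → S := fun i => Nat.rec ⟨U, hU, univ_subset_iff.1 hcov⟩ (fun i W => next i W) i
  have hs : ∀ i j, closure ((s (i + 1)).1 j) ⊆ (s i).1 j := fun i j => hnext i (s i) j
  have hanti : ∀ j, Antitone fun i => (s i).1 j := fun j =>
    antitone_nat_of_succ_le fun i => subset_closure.trans (hs i j)
  -- The order is at most `m` on `F i` from stage `i + 1` on, hence everywhere for the limit;
  -- finiteness of the index set keeps the limit a cover.
  let K : Fin n → Set X := fun j => ⋂ i, closure ((s (i + 1)).1 j)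
  have hcovK : ∀ x, ∃ j, x ∈ K j := by
    intro x
    by_contra! hc
    simp only [K, mem_iInter, not_forall] at hc
    choose i hi using hc
    obtain ⟨j, hj⟩ := mem_iUnion.1 ((s (Finset.univ.sup i + 1)).2.2.symm ▸ mem_univ x)
    exact hi j (subset_closure (hanti j
      (Nat.succ_le_succ (Finset.le_sup (f := i) (Finset.mem_univ j))) hj))
  obtain ⟨V, hV, hKV, hVU, hord⟩ := exists_open_swelling (m := m) (K := K) (U := U)
    (fun j => isClosed_iInter fun i => isClosed_closure) hU
    (fun j => (iInter_subset _ 0).trans (hs 0 j)) (fun x => by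
      obtain ⟨i, hi⟩ := mem_iUnion.1 (hcovF.symm ▸ mem_univ x)
      exact le_trans (encard_le_encard fun j hj => mem_iInter.1 hj i) (hnextord i (s i) x hi))
  refine ⟨V, hV, hVU, fun x _ => ?_, fun x _ => hord x⟩
  obtain ⟨j, hj⟩ := hcovK x
  exact mem_iUnion.2 ⟨j, hKV j hj⟩

theorem dimLTOn_of_inter_isClosed {m : ℕ} {A : Set X} {F : ℕ → Set X} (hF : ∀ i, IsClosed (F i))
    (hcov : A ⊆ ⋃ i, F i) (h : ∀ i, DimLTOn (A ∩ F i) m) : DimLTOn A m := by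
  rw [← dimLTOn_univ_subtype_iff]
  refine dimLTOn_univ_of_iUnion_isClosed (F := fun i => ((↑) : A → X) ⁻¹' F i)
    (fun i => (hF i).preimage continuous_subtype_val) ?_ fun i => ?_
  · rw [← preimage_iUnion, ← univ_subset_iff]
    exact fun x _ => hcov x.2
  · rw [← IsInducing.subtypeVal.dimLTOn_image_iff, Subtype.image_preimage_coe]
    exact h i

/-- The subset theorem. -/
theorem DimLTOn.of_univ {m : ℕ} (h : DimLTOn (univ : Set X) m) (A : Set X) : DimLTOn A m := by
  intro n U hU hcov
  have hO : IsOpen (⋃ j, U j) := isOpen_iUnion hU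
  -- The union of the family is open, hence an `F_σ`, so the closed sum theorem applies to it in
  -- place of `A`.
  obtain ⟨F, hF, -, hFO, -⟩ := hO.exists_iUnion_isClosed
  have hdim : DimLTOn (⋃ j, U j) m := dimLTOn_of_inter_isClosed hF hFO.ge fun i => by
    rw [inter_eq_self_of_subset_right (hFO ▸ subset_iUnion F i)]
    exact h.of_isClosed (hF i)
  obtain ⟨V, hV, hVU, hcovV, hord⟩ := hdim n U hU subset_rfl
  exact ⟨V, hV, hVU, hcov.trans hcovV, fun x hx => hord x (hcov hx)⟩

theorem DimLTOn.mono {m : ℕ} {A B : Set X} (h : DimLTOn B m) (hAB : A ⊆ B) : DimLTOn A m := by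
  have := (dimLTOn_univ_subtype_iff.2 h).of_univ ((↑) ⁻¹' A)
  rwa [← IsInducing.subtypeVal.dimLTOn_image_iff, Subtype.image_preimage_coe,
    inter_eq_self_of_subset_right hAB] at this

/-- Cutting each local shrinking down to the `r`-thickening of its own piece prevents it from
meeting any other piece. -/
theorem dimLTOn_iUnion_of_le_dist {ι : Type*} {m : ℕ} {C : ι → Set X} {r : ℝ} (hr : 0 < r)
    (hC : ∀ i k, i ≠ k → ∀ x ∈ C i, ∀ y ∈ C k, r ≤ dist x y) (h : ∀ i, DimLTOn (C i) m) :
    DimLTOn (⋃ i, C i) m := by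
  intro n U hU hcov
  choose V hV hVU hcovV hord using fun i => h i n U hU ((subset_iUnion C i).trans hcov)
  have hmem : ∀ i, ∀ x ∈ C i, ∀ j,
      x ∈ ⋃ k, V k j ∩ Metric.thickening r (C k) ↔ x ∈ V i j := by
    intro i x hx j
    rw [mem_iUnion]
    constructor
    · rintro ⟨k, hk, hxk⟩
      obtain ⟨y, hy, hxy⟩ := Metric.mem_thickening_iff.1 hxk
      by_cases hik : i = k
      · exact hik ▸ hk
      · exact absurd hxy (not_lt.2 (hC i k hik x hx y hy))
    · exact fun hxj => ⟨i, hxj, Metric.self_subset_thickening hr _ hx⟩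
  refine ⟨fun j => ⋃ k, V k j ∩ Metric.thickening r (C k),
    fun j => isOpen_iUnion fun k => (hV k j).inter Metric.isOpen_thickening,
    fun j => iUnion_subset fun k => inter_subset_left.trans (hVU k j), fun x hx => ?_,
    fun x hx => ?_⟩
  · obtain ⟨i, hi⟩ := mem_iUnion.1 hx
    obtain ⟨j, hj⟩ := mem_iUnion.1 (hcovV i hi)
    exact mem_iUnion.2 ⟨j, (hmem i x hi j).2 hj⟩
  · obtain ⟨i, hi⟩ := mem_iUnion.1 hx
    simp only [hmem i x hi]
    exact hord i x hi

theorem isClosed_iUnion_of_le_dist {ι : Type*} {C : ι → Set X} {r : ℝ} (hr : 0 < r)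
    (hC : ∀ i k, i ≠ k → ∀ x ∈ C i, ∀ y ∈ C k, r ≤ dist x y) (h : ∀ i, IsClosed (C i)) :
    IsClosed (⋃ i, C i) := by
  refine LocallyFinite.isClosed_iUnion (fun x => ⟨Metric.ball x (r / 2),
    Metric.ball_mem_nhds x (by positivity), Set.Subsingleton.finite ?_⟩) h
  rintro i ⟨y, hy, hyx⟩ k ⟨z, hz, hzx⟩
  by_contra hik
  have h₁ := hC i k hik y hy z hz
  have h₂ := dist_triangle_right y z x
  rw [Metric.mem_ball] at hyx hzx
  linarith

/-- A union of open sets of dimension `< m` has dimension `< m`. -/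
theorem dimLTOn_iUnion_of_isOpen {ι : Type*} {m : ℕ} {G : ι → Set X} (hG : ∀ i, IsOpen (G i))
    (h : ∀ i, DimLTOn (G i) m) : DimLTOn (⋃ i, G i) m := by
  obtain ⟨_, _⟩ := exists_wellFoundedLT ι
  let r : ℕ → ℝ := fun n => 1 / (n + 1)
  have hr : ∀ n, 0 < r n := fun n => by positivity
  -- After well-ordering the indices, keep the points of `G i` outside earlier members and at
  -- distance at least `r n` from `(G i)ᶜ`. For fixed `n` these closed pieces are uniformly
  -- separated.
  let C : ℕ → ι → Set X := fun n i => (Metric.thickening (r n) (G i)ᶜ)ᶜ ∩ (⋃ k ∈ Iio i, G k)ᶜ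
  have hCG : ∀ n i, C n i ⊆ G i := fun n i x hx => by
    by_contra hc
    exact hx.1 (Metric.self_subset_thickening (hr n) _ hc)
  have hCcl : ∀ n i, IsClosed (C n i) := fun n i =>
    Metric.isOpen_thickening.isClosed_compl.inter
      (isOpen_biUnion fun k _ => hG k).isClosed_compl
  have hlt : ∀ n i k, i < k → ∀ x ∈ C n i, ∀ y ∈ C n k, r n ≤ dist x y := by
    intro n i k hik x hx y hy
    by_contra! hc
    exact hx.1 (Metric.mem_thickening_iff.2 ⟨y, fun hyi => hy.2 (mem_biUnion hik hyi), hc⟩)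
  have hsep : ∀ n i k, i ≠ k → ∀ x ∈ C n i, ∀ y ∈ C n k, r n ≤ dist x y := by
    intro n i k hik x hx y hy
    rcases lt_or_gt_of_ne hik with hik | hik
    · exact hlt n i k hik x hx y hy
    · rw [dist_comm]
      exact hlt n k i hik y hy x hx
  refine dimLTOn_of_inter_isClosed (F := fun n => ⋃ i, C n i)
    (fun n => isClosed_iUnion_of_le_dist (hr n) (hsep n) (hCcl n)) (fun x hx => ?_) fun n =>
      (dimLTOn_iUnion_of_le_dist (hr n) (hsep n) fun i => (h i).mono (hCG n i)).mono
        inter_subset_right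
  obtain ⟨i, hi, hmin⟩ := WellFounded.has_min (wellFounded_lt (α := ι)) {i | x ∈ G i}
    (mem_iUnion.1 hx)
  obtain ⟨ε, hε, hball⟩ := Metric.isOpen_iff.1 (hG i) x hi
  obtain ⟨n, hn⟩ := exists_nat_one_div_lt hε
  refine mem_iUnion.2 ⟨n, mem_iUnion.2 ⟨i, fun hc => ?_, fun hc => ?_⟩⟩
  · obtain ⟨y, hy, hxy⟩ := Metric.mem_thickening_iff.1 hc
    exact hy (hball (by rw [Metric.mem_ball, dist_comm]; exact hxy.trans hn))
  · obtain ⟨k, hk, hxk⟩ := mem_iUnion₂.1 hc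
    exact hmin k hxk hk

/-- A space has dimension `< m` if each of its nonempty closed subsets has a nonempty relatively
open subset of dimension `< m`. -/
theorem dimLTOn_univ_of_forall_isClosed {m : ℕ}
    (h : ∀ B : Set X, IsClosed B → B.Nonempty →
      ∃ V, IsOpen V ∧ (V ∩ B).Nonempty ∧ DimLTOn (V ∩ B) m) : DimLTOn (univ : Set X) m := by
  let G : Set X := ⋃ W : {W : Set X // IsOpen W ∧ DimLTOn W m}, W.1
  have hG : IsOpen G := isOpen_iUnion fun W => W.2.1
  have hGdim : DimLTOn G m := dimLTOn_iUnion_of_isOpen (fun W => W.2.1) fun W => W.2.2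
  suffices hGu : G = univ by rwa [hGu] at hGdim
  by_contra hne
  obtain ⟨V, hV, ⟨x, hxV, hxG⟩, hVdim⟩ := h Gᶜ hG.isClosed_compl (nonempty_compl.2 hne)
  obtain ⟨F, hF, -, hFG, -⟩ := hG.exists_iUnion_isClosed
  -- `G` is an `F_σ` and the remainder lies in `V ∩ Gᶜ`, so the closed sum theorem contradicts the
  -- maximality of `G`.
  have hdim : DimLTOn (G ∪ V) m := by
    refine dimLTOn_of_inter_isClosed (F := fun i => Nat.casesOn i Gᶜ F) ?_ ?_ ?_
    · rintro (_ | i)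
      exacts [hG.isClosed_compl, hF i]
    · intro y _
      by_cases hy : y ∈ G
      · obtain ⟨i, hi⟩ := mem_iUnion.1 (hFG.symm ▸ hy)
        exact mem_iUnion.2 ⟨i + 1, hi⟩
      · exact mem_iUnion.2 ⟨0, hy⟩
    · rintro (_ | i)
      · exact hVdim.mono fun y hy => ⟨hy.1.resolve_left hy.2, hy.2⟩
      · exact hGdim.mono (inter_subset_right.trans (hFG ▸ subset_iUnion F i))
  exact hxG (mem_iUnion.2 ⟨⟨G ∪ V, hG.union hV, hdim⟩, Or.inr hxV⟩)

end Metric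

/-! ### Transfer of dimension along `f` -/

theorem ResolvableMeasurable.weaklyDiscontinuousOn {X : Type u} {Y : Type v} [TopologicalSpace X]
    [TopologicalSpace Y] [TopologicalSpace.MetrizableSpace X]
    [TopologicalSpace.MetrizableSpace Y] {f : X → Y} (hf : ResolvableMeasurable f) :
    WeaklyDiscontinuousOn f univ := by
  let _ := TopologicalSpace.metrizableSpaceMetric X
  exact weaklyDiscontinuousOn_univ_of_isLocallyDecided fun U hU => (hf U hU).isLocallyDecided

theorem Equiv.isInducing_comp_val_of_continuousOn {X : Type u} {Y : Type v} [TopologicalSpace X]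
    [TopologicalSpace Y] (f : X ≃ Y) {A : Set X} (hf : ContinuousOn f A)
    (hf' : ContinuousOn f.symm (f '' A)) : IsInducing fun a : A => f a := by
  let e : A ≃ f '' A := f.image A
  have he : Continuous e := hf.domRestrict.subtype_mk _
  have he' : Continuous e.symm := by
    rw [IsInducing.subtypeVal.continuous_iff]
    refine hf'.domRestrict.congr fun y => ?_
    obtain ⟨_, x, hx, rfl⟩ := y
    simp [e, Equiv.image]
  exact IsInducing.subtypeVal.comp (Homeomorph.mk e he he').isInducing

theorem HasCoveringDimLT.of_weaklyDiscontinuousOn {X : Type u} {Y : Type v} [TopologicalSpace X]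
    [TopologicalSpace Y] [TopologicalSpace.MetrizableSpace X]
    [TopologicalSpace.MetrizableSpace Y] (f : X ≃ Y) (hf : WeaklyDiscontinuousOn f univ)
    (hf' : WeaklyDiscontinuousOn f.symm univ) {m : ℕ} (hY : HasCoveringDimLT Y m) :
    HasCoveringDimLT X m := by
  let _ := TopologicalSpace.metrizableSpaceMetric X
  let _ := TopologicalSpace.metrizableSpaceMetric Y
  rw [hasCoveringDimLT_iff_dimLTOn_univ] at hY ⊢
  refine dimLTOn_univ_of_forall_isClosed fun B _ hBne => ?_
  obtain ⟨V, hV, hVB, hVc⟩ := hf B (subset_univ B) hBne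
  obtain ⟨W, hW, ⟨_, hyW, x, hx, rfl⟩, hWc⟩ := hf' (f '' (V ∩ B)) (subset_univ _) (hVB.image f)
  -- Continuity on `V ∩ B` pulls the good piece of the image back to a relatively open piece of `B`,
  -- where both directions are continuous.
  obtain ⟨O, hO, hOW⟩ := continuousOn_iff'.1 hVc W hW
  have hOVB : O ∩ V ∩ B = f ⁻¹' W ∩ (V ∩ B) := by rw [inter_assoc, hOW]
  refine ⟨O ∩ V, hO.inter hV, ⟨x, hOVB.symm ▸ ⟨hyW, hx⟩⟩, ?_⟩
  have hind := f.isInducing_comp_val_of_continuousOn (A := O ∩ V ∩ B)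
    (hVc.mono (hOVB ▸ inter_subset_right)) (hWc.mono (by
      rw [hOVB]
      rintro _ ⟨z, ⟨hzW, hz⟩, rfl⟩
      exact ⟨hzW, z, hz, rfl⟩))
  rw [← dimLTOn_univ_subtype_iff, ← hind.dimLTOn_image_iff]
  exact hY.of_univ _

theorem mainTheorem5 {X : Type u} {Y : Type v} [TopologicalSpace X] [TopologicalSpace Y]
    [TopologicalSpace.MetrizableSpace X] [TopologicalSpace.MetrizableSpace Y]
    (f : X ≃ Y) (hf : ResolvableMeasurable f) (hf' : ResolvableMeasurable f.symm) :
    coveringDim X = coveringDim Y := by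
  have hiff : ∀ m, HasCoveringDimLT X m ↔ HasCoveringDimLT Y m := fun m =>
    ⟨.of_weaklyDiscontinuousOn f.symm hf'.weaklyDiscontinuousOn hf.weaklyDiscontinuousOn,
      .of_weaklyDiscontinuousOn f hf.weaklyDiscontinuousOn hf'.weaklyDiscontinuousOn⟩
  simp only [coveringDim, hiff]
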